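/- Let $\Delta=\{z\in\mathbb{C}:|z|<1\}$ and $X=\Delta\times\mathbb{C}$. Here a subset of a topological space is called discrete if it has no accumulation point in that space (that is, it is closed and its subspace topology is discrete). An exhaustion function on $X$ is a continuous function $\rho:X\to[0,\infty)$ such that $\{x\in X:\rho(x)\le c\}$ is compact for every $c\ge 0$. An infinite discrete subset $D\subset X$ is called (weakly) tame if for every exhaustion function $\rho$ on $X$ and every map $\zeta:D\to[0,\infty)$ there exists a holomorphic automorphism $\phi$ of $X$ such that $\rho(\phi(x))\ge\zeta(x)$ for all $x\in D$. Let $D\subset X$ be an infinite discrete subset. Then $D$ is tame if and only if both of the following conditions hold: (i) the projection $\pi_1(D)=\{z\in\Delta:\exists w\in\mathbb{C},\ (z,w)\in D\}$ is discrete in $\Delta$; (ii) for every $p\in\Delta$ the fiber $\{(z,w)\in D: z=p\}$ is finite. -/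

import Mathlib

open Set TopologicalSpace
open scoped Manifold ContDiff NNReal

namespace TameSets

/-- `D` is a discrete subset of `X` in the sense of complex geometry: it is closed in `X` and its
subspace topology is discrete. Equivalently, `D` has no accumulation point in `X`. -/
def IsDiscreteSubset {X : Type*} [TopologicalSpace X] (D : Set X) : Prop :=
  IsClosed D ∧ DiscreteTopology D

/-- An exhaustion function on `X`: a continuous function `X → [0, ∞)` all of whose sublevel sets
are compact. -/
def IsExhaustion {X : Type*} [TopologicalSpace X] (ρ : X → ℝ≥0) : Prop :=
  Continuous ρ ∧ ∀ c : ℝ≥0, IsCompact {x : X | ρ x ≤ c}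

section Tame

-- `X` is a complex manifold: finite-dimensional, without boundary, Hausdorff, second countable.
variable {E : Type*} [NormedAddCommGroup E] [NormedSpace ℂ E] [FiniteDimensional ℂ E]
  {H : Type*} [TopologicalSpace H] (I : ModelWithCorners ℂ E H) [I.Boundaryless]
  (X : Type*) [TopologicalSpace X] [T2Space X] [SecondCountableTopology X]
  [ChartedSpace H X] [IsManifold I ω X]

/-- Holomorphic automorphisms of the complex manifold `X`: bijections of `X` that are complex
analytic together with their inverses. -/
abbrev HolAut : Type _ := X ≃ₘ^ω⟮I, I⟯ X

variable {X}

/-- (Weak) tameness of a subset `D` of a complex manifold `X`: `D` is an infinite discrete subset,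
and for every exhaustion function `ρ` of `X` and every `ζ : D → [0, ∞)` there is a holomorphic
automorphism `φ` of `X` with `ρ (φ x) ≥ ζ x` for all `x ∈ D`. -/
def IsTame (D : Set X) : Prop :=
  D.Infinite ∧ IsDiscreteSubset D ∧
    ∀ ρ : X → ℝ≥0, IsExhaustion ρ → ∀ ζ : D → ℝ≥0,
      ∃ φ : HolAut I X, ∀ x : D, ρ (φ x) ≥ ζ x

end Tame

/-- The open unit disc `Δ = {z ∈ ℂ : |z| < 1}`, as an open submanifold of `ℂ`. -/
def disc : Opens ℂ := ⟨{z : ℂ | ‖z‖ < 1}, isOpen_lt continuous_norm continuous_const⟩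

end TameSets

open Filter Topology Metric

/-! Necessity is a growth argument. On a fiber `{z} × ℂ` the first component of an automorphism is a
bounded entire function, hence constant, and the second has an entire left inverse, hence is affine
(`HolAut.apply_eq_affine`). The coefficients are continuous in `z`, so over a compact subset of `Δ`
the standard exhaustion composed with the automorphism grows at most linearly in `w`. Requiring
quadratic growth on `D` therefore bounds `D` over that compact set, leaving finitely many points
(`IsTame.finite_over_compact`).

For sufficiency, finiteness of each fiber lets a single translation push all its points far enough
out. Discreteness of the projection lets a holomorphic function on `Δ` interpolate these
translations, and the resulting shear is the automorphism sought. -/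

/-- An entire function of at most linear growth is affine. -/
theorem eq_affine_of_norm_le_linear {g : ℂ → ℂ} (hg : Differentiable ℂ g) {A B : ℝ}
    (h : ∀ w, ‖g w‖ ≤ A + B * ‖w‖) : ∃ c, ∀ w, g w = g 0 + c * w := by
  have hd : Differentiable ℂ (dslope g 0) := by
    rw [← differentiableOn_univ] at hg ⊢
    exact (Complex.differentiableOn_dslope univ_mem).2 hg
  have hb : Bornology.IsBounded (range (dslope g 0)) := by
    obtain ⟨M, hM⟩ := (isCompact_closedBall (0 : ℂ) 1).exists_bound_of_continuousOn
      hd.continuous.continuousOn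
    refine isBounded_iff_forall_norm_le.2 ⟨max M (|A| + |B| + ‖g 0‖), ?_⟩
    rintro _ ⟨w, rfl⟩
    rcases le_or_gt ‖w‖ 1 with hw | hw
    · exact (hM w (by simpa using hw)).trans (le_max_left _ _)
    · refine le_trans ?_ (le_max_right _ _)
      have hw0 : w ≠ 0 := by rintro rfl; simp at hw; linarith
      have hwp : 0 < ‖w‖ := by linarith
      rw [dslope_of_ne _ hw0, slope_def_field, sub_zero, norm_div, div_le_iff₀ hwp]
      calc ‖g w - g 0‖ ≤ ‖g w‖ + ‖g 0‖ := norm_sub_le _ _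
        _ ≤ |A| + |B| * ‖w‖ + ‖g 0‖ := by
          gcongr
          refine (h w).trans ?_
          gcongr
          · exact le_abs_self A
          · exact le_abs_self B
        _ ≤ (|A| + |B| + ‖g 0‖) * ‖w‖ := by
          nlinarith [abs_nonneg A, norm_nonneg (g 0)]
  refine ⟨dslope g 0 0, fun w => ?_⟩
  rw [hd.apply_eq_apply_of_bounded hb 0 w]
  have := sub_smul_dslope g 0 w
  simp only [sub_zero, smul_eq_mul] at this
  linear_combination -this

/-- An entire function with an entire left inverse is affine. -/
theorem eq_affine_of_leftInverse {f g : ℂ → ℂ} (hf : Differentiable ℂ f)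
    (hg : Differentiable ℂ g) (h : Function.LeftInverse g f) (w : ℂ) :
    f w = f 0 + (f 1 - f 0) * w := by
  have hd : Differentiable ℂ (dslope f 0) := by
    rw [← differentiableOn_univ] at hf ⊢
    exact (Complex.differentiableOn_dslope univ_mem).2 hf
  have hne : ∀ w, dslope f 0 w ≠ 0 := by
    intro w
    rcases eq_or_ne w 0 with rfl | hw
    · rw [dslope_same]
      intro h0
      have h1 : HasDerivAt (g ∘ f) (deriv g (f 0) * deriv f 0) 0 :=
        (hg (f 0)).hasDerivAt.comp 0 (hf 0).hasDerivAt
      rw [h.id, h0, mul_zero] at h1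
      exact zero_ne_one (h1.unique (hasDerivAt_id 0))
    · rw [dslope_of_ne _ hw, slope_def_field]
      exact div_ne_zero (sub_ne_zero.2 (h.injective.ne hw)) (sub_ne_zero.2 hw)
  have hk : Differentiable ℂ fun w => (dslope f 0 w)⁻¹ := hd.inv hne
  obtain ⟨R, hR⟩ := (isCompact_closedBall (f 0) 1).exists_bound_of_continuousOn
    hg.continuous.continuousOn
  obtain ⟨M, hM⟩ := (isCompact_closedBall (0 : ℂ) (max R 0)).exists_bound_of_continuousOn
    hk.continuous.continuousOn
  obtain ⟨c, hc⟩ := eq_affine_of_norm_le_linear hk (A := |M|) (B := 1) fun w => by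
    rcases le_or_gt ‖w‖ (max R 0) with hw | hw
    · have := hM w (by simpa using hw)
      linarith [le_abs_self M, norm_nonneg w]
    · have hw0 : w ≠ 0 := by
        rintro rfl
        simp at hw
      -- `g` is bounded by `R` on the unit ball around `f 0` and `g (f w) = w`, so `f w` lies
      -- outside that ball once `‖w‖ > R`. Hence the reciprocal of the slope grows at most linearly.
      have h1 : 1 < ‖f w - f 0‖ := by
        by_contra! hcon
        have := hR (f w) (by simpa [dist_eq_norm] using hcon)
        rw [h w] at this
        exact absurd (hw.trans_le this) (by simp)
      rw [dslope_of_ne _ hw0, slope_def_field, sub_zero, norm_inv, norm_div, inv_div,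
        div_le_iff₀ (by linarith)]
      nlinarith [abs_nonneg M, norm_nonneg w]
  -- An affine function with nonzero slope has a zero, but a reciprocal of a nonvanishing function
  -- has none.
  have hc0 : c = 0 := by
    by_contra hc0
    have := hc (-(dslope f 0 0)⁻¹ / c)
    rw [mul_div_cancel₀ _ hc0, add_neg_cancel] at this
    exact inv_ne_zero (hne _) this
  have hconst : ∀ w, dslope f 0 w = dslope f 0 0 := fun w => by
    simpa [hc0] using hc w
  have key : ∀ w, f w = f 0 + w * dslope f 0 0 := fun w => by
    have := sub_smul_dslope f 0 w
    simp only [sub_zero, smul_eq_mul, hconst w] at this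
    linear_combination -this
  rw [key w, key 1]
  ring

/-! ### Holomorphic interpolation on the disc -/

/-- Interpolation at finitely many points outside a disc by an entire function that is small on
the disc and vanishes at finitely many further points. -/
theorem exists_entire_interpolation_small {r : ℝ} (hr : 0 ≤ r) {A B : Finset ℂ}
    (hAB : Disjoint A B) (hB : ∀ p ∈ B, r < ‖p‖) (v : ℂ → ℂ) {ε : ℝ} (hε : 0 < ε) :
    ∃ g : ℂ → ℂ, Differentiable ℂ g ∧ (∀ p ∈ A, g p = 0) ∧ (∀ p ∈ B, g p = v p) ∧
      ∀ z ∈ closedBall (0 : ℂ) r, ‖g z‖ ≤ ε := by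
  classical
  let l : ℂ → Polynomial ℂ := fun p => Lagrange.basis (A ∪ B) id p
  have hM : ∀ p, ∃ M, ∀ z ∈ closedBall (0 : ℂ) r, ‖v p * (l p).eval z‖ ≤ M := fun p =>
    (isCompact_closedBall (0 : ℂ) r).exists_bound_of_continuousOn (by fun_prop)
  choose M hM using hM
  have hlim : Tendsto (fun N : ℕ => ∑ p ∈ B, M p * (r / ‖p‖) ^ N) atTop (𝓝 0) := by
    rw [← Finset.sum_const_zero (s := B) (M := ℝ)]
    refine tendsto_finsetSum _ fun p hp => ?_
    have hp0 : 0 < ‖p‖ := hr.trans_lt (hB p hp)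
    simpa using (tendsto_pow_atTop_nhds_zero_of_lt_one (by positivity)
      ((div_lt_one hp0).2 (hB p hp))).const_mul (M p)
  obtain ⟨N, hN⟩ := (hlim.eventually_lt_const hε).exists
  -- The factor `(z / p) ^ N` equals `1` at `p` and tends to `0` uniformly on the disc of radius `r
  -- < ‖p‖`.
  refine ⟨fun z => ∑ p ∈ B, v p * (l p).eval z * (z / p) ^ N, by fun_prop, ?_, ?_, ?_⟩
  · intro q hq
    refine Finset.sum_eq_zero fun p hp => ?_
    have : (l p).eval q = 0 := Lagrange.eval_basis_of_ne (v := id) (s := A ∪ B)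
      (fun h => Finset.disjoint_left.1 hAB hq (h ▸ hp)) (Finset.mem_union_left _ hq)
    simp [this]
  · intro q hq
    have hq0 : q ≠ 0 := norm_pos_iff.1 (hr.trans_lt (hB q hq))
    have h1 : (l q).eval q = 1 := Lagrange.eval_basis_self (v := id) (s := A ∪ B)
      Function.injective_id.injOn (Finset.mem_union_right _ hq)
    dsimp only
    rw [Finset.sum_eq_single_of_mem q hq fun p _ hpq => ?_, h1, div_self hq0, one_pow, mul_one,
      mul_one]
    have : (l p).eval q = 0 := Lagrange.eval_basis_of_ne (v := id) (s := A ∪ B) hpq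
      (Finset.mem_union_right _ hq)
    simp [this]
  · intro z hz
    refine (norm_sum_le _ _).trans (le_trans (Finset.sum_le_sum fun p hp => ?_) hN.le)
    have hz' : ‖z‖ ≤ r := by simpa using hz
    rw [norm_mul, norm_pow, norm_div]
    have := hM p z hz
    have hp0 : 0 < ‖p‖ := hr.trans_lt (hB p hp)
    gcongr
    exact (norm_nonneg _).trans this

/-- Interpolation of arbitrary values on a locally finite subset of the unit disc by a
holomorphic function on the disc. -/
theorem exists_differentiableOn_ball_interpolation {P : Set ℂ} (hP1 : P ⊆ ball 0 1)
    (hP : ∀ r < 1, (P ∩ closedBall 0 r).Finite) (v : ℂ → ℂ) :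
    ∃ b : ℂ → ℂ, DifferentiableOn ℂ b (ball 0 1) ∧ ∀ p ∈ P, b p = v p := by
  let r : ℕ → ℝ := fun n => 1 - 1 / ((n : ℝ) + 1)
  have hr1 : ∀ n, r n < 1 := fun n => by
    have : (0 : ℝ) < 1 / ((n : ℝ) + 1) := by positivity
    simp only [r]; linarith
  have hr0 : ∀ n, 0 ≤ r n := fun n => by
    have : 1 / ((n : ℝ) + 1) ≤ 1 := by
      rw [div_le_one (by positivity)]; linarith [n.cast_nonneg (α := ℝ)]
    simp only [r]; linarith
  have hmono : Monotone r := fun m n hmn => by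
    simp only [r]; gcongr
  have hex : ∀ z ∈ ball (0 : ℂ) 1, ∃ m, ‖z‖ < r m := fun z hz => by
    have hz' : ‖z‖ < 1 := by simpa using hz
    obtain ⟨m, hm⟩ := exists_nat_one_div_lt (sub_pos.2 hz')
    exact ⟨m, by simp only [r]; linarith⟩
  let F : ℕ → Type := fun n =>
    {f : ℂ → ℂ // Differentiable ℂ f ∧ ∀ p ∈ P ∩ closedBall 0 (r n), f p = v p}
  -- The correction vanishes at the points already treated, so values once attained persist in the
  -- limit.
  have step : ∀ n (f : F n), ∃ f' : F (n + 1),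
      ∀ z ∈ closedBall (0 : ℂ) (r n), ‖f.1 z - f'.1 z‖ ≤ (1 / 2) ^ n := by
    intro n f
    classical
    have hfin := hP (r (n + 1)) (hr1 _)
    let A := (hP (r n) (hr1 n)).toFinset
    let B := hfin.toFinset \ A
    obtain ⟨g, hg, hgA, hgB, hgε⟩ := exists_entire_interpolation_small (hr0 n)
      (A := A) (B := B) Finset.disjoint_sdiff (fun p hp => by
        by_contra! hcon
        simp only [B, A, Finset.mem_sdiff, Finite.mem_toFinset] at hp
        exact hp.2 ⟨hp.1.1, by simpa using hcon⟩) (fun p => v p - f.1 p)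
      (ε := (1 / 2) ^ n) (by positivity)
    refine ⟨⟨fun z => f.1 z + g z, f.2.1.add hg, fun p hp => ?_⟩, fun z hz => ?_⟩
    · dsimp only
      by_cases hpA : p ∈ A
      · rw [hgA p hpA, add_zero]
        exact f.2.2 p (by simpa [A] using hpA)
      · rw [hgB p (by simp only [B, Finset.mem_sdiff, Finite.mem_toFinset]; exact ⟨hp, hpA⟩)]
        ring
    · simpa using hgε z hz
  choose S hS using step
  -- Since `r 0 = 0`, the only possible initial node is the origin.
  let f0 : F 0 := ⟨fun _ => v 0, differentiable_const _, fun p hp => by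
    have : p = 0 := by simpa [r] using hp.2
    rw [this]⟩
  let f : ∀ n, F n := fun n => Nat.rec f0 S n
  have hf : ∀ n, ∀ z ∈ closedBall (0 : ℂ) (r n),
      ‖(f n).1 z - (f (n + 1)).1 z‖ ≤ (1 / 2) ^ n := fun n => hS n (f n)
  have hfm : ∀ m, ∀ z ∈ closedBall (0 : ℂ) (r m), ∀ k,
      dist ((f (k + m)).1 z) ((f (k + 1 + m)).1 z) ≤ (1 / 2) ^ m * (1 / 2) ^ k := by
    intro m z hz k
    rw [dist_eq_norm, ← pow_add, add_comm m k, add_right_comm]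
    exact hf _ z (closedBall_subset_closedBall (hmono (Nat.le_add_left _ _)) hz)
  have hb : ∀ z, ∃ l, z ∈ ball (0 : ℂ) 1 → Tendsto (fun n => (f n).1 z) atTop (𝓝 l) := by
    intro z
    by_cases hz : z ∈ ball (0 : ℂ) 1
    · obtain ⟨m, hm⟩ := hex z hz
      obtain ⟨l, hl⟩ := cauchySeq_tendsto_of_complete
        (cauchySeq_of_le_geometric _ _ (by norm_num) (hfm m z (by simpa using hm.le)))
      exact ⟨l, fun _ => (tendsto_add_atTop_iff_nat (f := fun n => (f n).1 z) m).1 hl⟩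
    · exact ⟨0, fun h => absurd h hz⟩
  choose b hb using hb
  refine ⟨b, fun z hz => ?_, fun p hp => ?_⟩
  · obtain ⟨m, hm⟩ := hex z hz
    have hU : TendstoUniformlyOn (fun n => (f (n + m)).1) b atTop (ball 0 (r m)) := by
      rw [Metric.tendstoUniformlyOn_iff]
      intro ε hε
      have hlim : Tendsto (fun n : ℕ => (1 / 2 : ℝ) ^ m * (1 / 2) ^ n / (1 - 1 / 2)) atTop
          (𝓝 0) := by
        simpa using ((tendsto_pow_atTop_nhds_zero_of_lt_one (r := (1 / 2 : ℝ)) (by norm_num)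
          (by norm_num)).const_mul ((1 / 2 : ℝ) ^ m)).div_const (1 - 1 / 2)
      filter_upwards [hlim.eventually_lt_const hε] with n hn w hw
      rw [dist_comm]
      refine lt_of_le_of_lt (dist_le_of_le_geometric_of_tendsto _ _ (by norm_num)
        (hfm m w (ball_subset_closedBall hw)) ?_ n) hn
      exact (tendsto_add_atTop_iff_nat (f := fun n => (f n).1 w) m).2
        (hb w (ball_subset_ball (hr1 m).le hw))
    have hd := hU.tendstoLocallyUniformlyOn.differentiableOn
      (Eventually.of_forall fun n => (f (n + m)).2.1.differentiableOn) isOpen_ball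
    exact (hd.differentiableAt (isOpen_ball.mem_nhds (by simpa using hm))).differentiableWithinAt
  · obtain ⟨m, hm⟩ := hex p (hP1 hp)
    refine tendsto_nhds_unique (hb p (hP1 hp)) (tendsto_const_nhds.congr' ?_)
    filter_upwards [eventually_ge_atTop m] with n hn
    exact ((f n).2.2 p ⟨hp, by simpa using hm.le.trans (hmono hn)⟩).symm

/-! ### Discrete sets and automorphisms of `Δ × ℂ` -/

namespace TameSets

/-- A discrete subset meets every compact set in a finite set. -/
theorem IsDiscreteSubset.finite_inter {X : Type*} [TopologicalSpace X] {D K : Set X}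
    (hD : IsDiscreteSubset D) (hK : IsCompact K) : (D ∩ K).Finite :=
  (hK.inter_left hD.1).finite (IsDiscrete.mono ⟨hD.2⟩ inter_subset_left)

/-- A subset that is locally finite is discrete. -/
theorem isDiscreteSubset_of_finite_inter {X : Type*} [TopologicalSpace X] [T1Space X] {D : Set X}
    (h : ∀ x, ∃ U ∈ 𝓝 x, (D ∩ U).Finite) : IsDiscreteSubset D := by
  have : IsClosed D ∧ IsDiscrete D := by
    refine isClosed_and_discrete_iff.2 fun x => ?_
    obtain ⟨U, hU, hfin⟩ := h x
    rw [disjoint_principal_right]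
    have h1 : ((D ∩ U) \ {x})ᶜ ∈ 𝓝 x :=
      (hfin.subset sdiff_subset).isClosed.isOpen_compl.mem_nhds (by simp)
    filter_upwards [mem_nhdsWithin_of_mem_nhds h1, mem_nhdsWithin_of_mem_nhds hU,
      self_mem_nhdsWithin] with y hy hyU hyx hyD
    exact hy ⟨⟨hyD, hyU⟩, hyx⟩
  exact ⟨this.1, this.2.to_subtype⟩

theorem norm_coe_disc_lt (z : disc) : ‖(z : ℂ)‖ < 1 := z.2

/-- The closed disc of radius `r` in the unit disc. -/
def closedDisc (r : ℝ) : Set disc := {z | ‖(z : ℂ)‖ ≤ r}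

theorem isCompact_closedDisc {r : ℝ} (hr : r < 1) : IsCompact (closedDisc r) := by
  rw [Subtype.isCompact_iff]
  convert isCompact_closedBall (0 : ℂ) r
  ext z
  simp only [closedDisc, mem_image, mem_ofPred_eq, mem_closedBall, dist_zero_right]
  exact ⟨by rintro ⟨z, hz, rfl⟩; exact hz, fun hz => ⟨⟨z, hz.trans_lt hr⟩, hz, rfl⟩⟩

theorem closedDisc_mem_nhds (z : disc) : ∃ r < 1, closedDisc r ∈ 𝓝 z := by
  obtain ⟨r, hzr, hr⟩ := exists_between (norm_coe_disc_lt z)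
  exact ⟨r, hr, (continuous_norm.comp continuous_subtype_val).continuousAt.preimage_mem_nhds
    (Iic_mem_nhds hzr)⟩

/-- The exhaustion function `1 / (1 - |z|) + |w|` of `Δ × ℂ`. -/
noncomputable def standardExhaustion (x : disc × ℂ) : ℝ≥0 :=
  ⟨(1 - ‖(x.1 : ℂ)‖)⁻¹ + ‖x.2‖,
    add_nonneg (inv_nonneg.2 (sub_nonneg.2 (norm_coe_disc_lt x.1).le)) (norm_nonneg _)⟩

theorem isExhaustion_standardExhaustion : IsExhaustion standardExhaustion := by
  have hc : Continuous standardExhaustion := by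
    refine Continuous.subtype_mk (Continuous.add (Continuous.inv₀ ?_ ?_) ?_) _
    · fun_prop
    · exact fun x => (sub_pos.2 (norm_coe_disc_lt x.1)).ne'
    · fun_prop
  refine ⟨hc, fun c => ?_⟩
  -- Using `c + 1` instead of `c` keeps the radius below `1` even when `c = 0`.
  have hr : 1 - ((c : ℝ) + 1)⁻¹ < 1 := by
    have : 0 < ((c : ℝ) + 1)⁻¹ := by positivity
    linarith
  refine ((isCompact_closedDisc hr).prod (isCompact_closedBall (0 : ℂ) c)).of_isClosed_subset
    (isClosed_le hc continuous_const) fun x hx => ?_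
  have hx' : (1 - ‖(x.1 : ℂ)‖)⁻¹ + ‖x.2‖ ≤ c := hx
  have h1 : 0 < 1 - ‖(x.1 : ℂ)‖ := sub_pos.2 (norm_coe_disc_lt x.1)
  have h2 : 0 < (1 - ‖(x.1 : ℂ)‖)⁻¹ := inv_pos.2 h1
  refine ⟨?_, by simpa using (by linarith : ‖x.2‖ ≤ c)⟩
  have h3 : ((c : ℝ) + 1)⁻¹ ≤ 1 - ‖(x.1 : ℂ)‖ :=
    inv_le_of_inv_le₀ h1 (by linarith [norm_nonneg x.2])
  change ‖(x.1 : ℂ)‖ ≤ _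
  linarith

/-- An automorphism of `Δ × ℂ` permutes the fibers over `Δ` and is affine on each of them. -/
theorem HolAut.apply_eq_affine (φ : HolAut (𝓘(ℂ, ℂ).prod 𝓘(ℂ, ℂ)) (disc × ℂ)) (z : disc) (w : ℂ) :
    (φ (z, w)).1 = (φ (z, 0)).1 ∧
      (φ (z, w)).2 = (φ (z, 0)).2 + ((φ (z, 1)).2 - (φ (z, 0)).2) * w := by
  have hslice : ∀ (ψ : HolAut (𝓘(ℂ, ℂ).prod 𝓘(ℂ, ℂ)) (disc × ℂ)) (z : disc),
      ContMDiff 𝓘(ℂ, ℂ) (𝓘(ℂ, ℂ).prod 𝓘(ℂ, ℂ)) ω fun w : ℂ => ψ (z, w) := fun ψ z =>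
    ψ.contMDiff.comp (contMDiff_const.prodMk contMDiff_id)
  have hsnd : ∀ (ψ : HolAut (𝓘(ℂ, ℂ).prod 𝓘(ℂ, ℂ)) (disc × ℂ)) (z : disc),
      Differentiable ℂ fun w : ℂ => (ψ (z, w)).2 := fun ψ z =>
    (contMDiff_iff_contDiff.1 (contMDiff_snd.comp (hslice ψ z))).differentiable (by simp)
  have hfst : Differentiable ℂ fun w : ℂ => ((φ (z, w)).1 : ℂ) :=
    (contMDiff_iff_contDiff.1
      (contMDiff_subtype_val.comp (contMDiff_fst.comp (hslice φ z)))).differentiable (by simp)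
  have h1 : ∀ w, (φ (z, w)).1 = (φ (z, 0)).1 := fun w => by
    refine Subtype.ext (hfst.apply_eq_apply_of_bounded ?_ w 0)
    refine isBounded_iff_forall_norm_le.2 ⟨1, ?_⟩
    rintro _ ⟨w, rfl⟩
    exact (norm_coe_disc_lt _).le
  refine ⟨h1 w, eq_affine_of_leftInverse (hsnd φ z) (hsnd φ.symm (φ (z, 0)).1) (fun w => ?_) w⟩
  dsimp only
  rw [← h1 w]
  exact congrArg Prod.snd (φ.symm_apply_apply (z, w))

/-- The shear `(z, w) ↦ (z, w + b z)` of `Δ × ℂ`. -/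
def shear (b : disc → ℂ) (hb : ContMDiff 𝓘(ℂ, ℂ) 𝓘(ℂ, ℂ) ω b) :
    HolAut (𝓘(ℂ, ℂ).prod 𝓘(ℂ, ℂ)) (disc × ℂ) where
  toFun x := (x.1, x.2 + b x.1)
  invFun x := (x.1, x.2 - b x.1)
  left_inv x := by simp
  right_inv x := by simp
  contMDiff_toFun := contMDiff_fst.prodMk (contMDiff_snd.add (hb.comp contMDiff_fst))
  contMDiff_invFun := contMDiff_fst.prodMk (contMDiff_snd.sub (hb.comp contMDiff_fst))

/-- A tame subset of `Δ × ℂ` has only finitely many points over each compact subset of `Δ`. -/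
theorem IsTame.finite_over_compact {D : Set (disc × ℂ)}
    (hD : IsTame (𝓘(ℂ, ℂ).prod 𝓘(ℂ, ℂ)) D) {K : Set disc} (hK : IsCompact K) :
    {x | x ∈ D ∧ x.1 ∈ K}.Finite := by
  obtain ⟨-, hdisc, htame⟩ := hD
  obtain ⟨φ, hφ⟩ := htame _ isExhaustion_standardExhaustion fun x => (1 + ‖x.1.2‖₊) ^ 2
  have hcont : Continuous φ := φ.contMDiff.continuous
  obtain ⟨M, hM⟩ := hK.exists_bound_of_continuousOn
    (f := fun z : disc => (standardExhaustion (φ (z, 0)) : ℝ))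
    (NNReal.continuous_coe.comp (isExhaustion_standardExhaustion.1.comp
      (hcont.comp (by fun_prop)))).continuousOn
  obtain ⟨C, hC⟩ := hK.exists_bound_of_continuousOn
    (f := fun z : disc => (φ (z, 1)).2 - (φ (z, 0)).2) (by fun_prop)
  -- The inequality `(1 + ‖w‖) ^ 2 ≤ |M| + |C| * ‖w‖` fails as soon as `‖w‖ > |M| + |C|`.
  refine (hdisc.finite_inter (hK.prod (isCompact_closedBall (0 : ℂ) (|M| + |C|)))).subset ?_
  rintro ⟨z, w⟩ ⟨hxD, hxK⟩
  refine ⟨hxD, hxK, ?_⟩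
  have h1 : (1 + ‖w‖) ^ 2 ≤ (standardExhaustion (φ (z, w)) : ℝ) := by
    exact_mod_cast hφ ⟨(z, w), hxD⟩
  obtain ⟨ha, hb⟩ := HolAut.apply_eq_affine φ z w
  have h2 : (standardExhaustion (φ (z, w)) : ℝ) ≤ |M| + |C| * ‖w‖ := by
    have hM' : (1 - ‖((φ (z, 0)).1 : ℂ)‖)⁻¹ + ‖(φ (z, 0)).2‖ ≤ |M| :=
      (le_abs_self _).trans ((hM z hxK).trans (le_abs_self M))
    have hC' : ‖((φ (z, 1)).2 - (φ (z, 0)).2) * w‖ ≤ |C| * ‖w‖ := by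
      rw [norm_mul]
      gcongr
      exact (hC z hxK).trans (le_abs_self C)
    change (1 - ‖((φ (z, w)).1 : ℂ)‖)⁻¹ + ‖(φ (z, w)).2‖ ≤ _
    rw [ha, hb]
    linarith [norm_add_le (φ (z, 0)).2 (((φ (z, 1)).2 - (φ (z, 0)).2) * w)]
  rw [mem_closedBall, dist_zero_right]
  nlinarith [norm_nonneg w, abs_nonneg M, abs_nonneg C]

/-- A discrete subset of `Δ × ℂ` with finite fibers over a discrete subset of `Δ` can be moved
towards infinity arbitrarily fast by a shear. -/
theorem exists_holAut_ge {D : Set (disc × ℂ)}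
    (hP : IsDiscreteSubset {z : disc | ∃ w : ℂ, (z, w) ∈ D})
    (hfib : ∀ p : disc, {x : disc × ℂ | x ∈ D ∧ x.1 = p}.Finite) {ρ : disc × ℂ → ℝ≥0}
    (hρ : IsExhaustion ρ) (ζ : D → ℝ≥0) :
    ∃ φ : HolAut (𝓘(ℂ, ℂ).prod 𝓘(ℂ, ℂ)) (disc × ℂ), ∀ x : D, ρ (φ x) ≥ ζ x := by
  have hv : ∀ p : disc, ∃ v : ℂ, ∀ x : D, x.1.1 = p → ρ (p, x.1.2 + v) ≥ ζ x := by
    intro p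
    -- For each point the bad translations form a compact set, so those of a finite fiber can be
    -- avoided together.
    have htend : ∀ x : D, ∀ᶠ v in cocompact ℂ, ρ (p, x.1.2 + v) ≥ ζ x := by
      intro x
      have hc : IsCompact ((fun v : ℂ => (p, x.1.2 + v)) ⁻¹' {y | ρ y ≤ ζ x}) := by
        have hcl := (isClosed_le hρ.1 (continuous_const (y := ζ x))).preimage
          (by fun_prop : Continuous fun v : ℂ => (p, x.1.2 + v))
        exact ((hρ.2 (ζ x)).image (by fun_prop : Continuous fun y : disc × ℂ => y.2 - x.1.2)
          ).of_isClosed_subset hcl fun v hv => ⟨_, hv, by simp⟩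
      filter_upwards [hc.compl_mem_cocompact] with v hv
      exact (not_le.1 (show ¬ρ (p, x.1.2 + v) ≤ ζ x from hv)).le
    have hfin : {x : D | x.1.1 = p}.Finite :=
      ((hfib p).preimage Subtype.val_injective.injOn).subset fun x hx => ⟨x.2, hx⟩
    exact ((hfin.eventually_all).2 fun x _ => htend x).exists
  choose v hv using hv
  obtain ⟨b, hb, hbv⟩ := exists_differentiableOn_ball_interpolation
    (P := Subtype.val '' {z : disc | ∃ w : ℂ, (z, w) ∈ D})
    (by rintro _ ⟨z, -, rfl⟩; simpa using norm_coe_disc_lt z)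
    (fun r hr => ((hP.finite_inter (isCompact_closedDisc hr)).image Subtype.val).subset (by
      rintro _ ⟨⟨z, hz, rfl⟩, hzr⟩
      exact ⟨z, ⟨hz, by simpa [closedDisc] using hzr⟩, rfl⟩))
    -- The default value `0` off the disc plays no role, as all nodes lie in the disc.
    (Function.extend Subtype.val v 0)
  have hbm : ContMDiff 𝓘(ℂ, ℂ) 𝓘(ℂ, ℂ) ω fun z : disc => b z := by
    intro z
    rw [contMDiffAt_subtype_iff, contMDiffAt_iff_contDiffAt]
    exact (hb.analyticAt (isOpen_ball.mem_nhds
      (by simpa using norm_coe_disc_lt z))).contDiffAt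
  refine ⟨shear _ hbm, fun x => ?_⟩
  have := hv x.1.1 x rfl
  rwa [← Subtype.val_injective.extend_apply v 0, ← hbv x.1.1 ⟨x.1.1, ⟨x.1.2, x.2⟩, rfl⟩] at this

end TameSets

theorem mainTheorem9 (D : Set (TameSets.disc × ℂ)) (hD : TameSets.IsDiscreteSubset D)
    (hinf : D.Infinite) :
    TameSets.IsTame (𝓘(ℂ, ℂ).prod 𝓘(ℂ, ℂ)) D ↔
      TameSets.IsDiscreteSubset {z : TameSets.disc | ∃ w : ℂ, (z, w) ∈ D} ∧
        ∀ p : TameSets.disc, {x : TameSets.disc × ℂ | x ∈ D ∧ x.1 = p}.Finite := by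
  constructor
  · intro h
    refine ⟨TameSets.isDiscreteSubset_of_finite_inter fun z => ?_, fun p => ?_⟩
    · obtain ⟨r, hr, hz⟩ := TameSets.closedDisc_mem_nhds z
      refine ⟨_, hz, ((h.finite_over_compact (TameSets.isCompact_closedDisc hr)).image
        Prod.fst).subset ?_⟩
      rintro p ⟨⟨w, hw⟩, hp⟩
      exact ⟨(p, w), ⟨hw, hp⟩, rfl⟩
    · simpa using h.finite_over_compact (isCompact_singleton (x := p))
  · rintro ⟨hP, hfib⟩
    exact ⟨hinf, hD, fun ρ hρ ζ => TameSets.exists_holAut_ge hP hfib hρ ζ⟩
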